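/- **Setting.** Let $(\mathcal C,\mathcal M)$ be an adhesive HLR category with all pullbacks, initial pushouts over $\mathcal M$-morphisms, an $\mathcal M$-initial object $\bot$ (an initial object all of whose outgoing morphisms $!_A\colon\bot\to A$ lie in $\mathcal M$), and a class $\mathcal E'$ of cospans such that every cospan factors, uniquely up to isomorphism, as a cospan in $\mathcal E'$ followed by an $\mathcal M$-morphism. *Conditions.* Nested conditions over an object $P_0$ are built from $\mathrm{true}$, Boolean combinations, and $\exists(p_1\colon P_0\to P_1,d)$ with $d$ a condition over $P_1$. A morphism $q\colon P_0\to G$ satisfies $\exists(p_1,d)$ if there is $q_1\colon P_1\to G$ in $\mathcal M$ with $q=q_1\circ p_1$ and $q_1\models d$; Boolean combinations are interpreted as usual, and $\forall(p,d):=\neg\exists(p,\neg d)$. Conditions are in $\mathcal M$-normal form: all morphisms in them, except possibly those starting at $P_0$, lie in $\mathcal M$. The tree of a condition has the root $P_0$ and one node for each quantified object, with the morphisms $p$ of the quantifiers as edges; a node is existentially (universally) bound if its quantifier is $\exists$ ($\forall$) after all negations have been pushed inward. A leaf is a node without outgoing edges. *Rules and transformations.* Rules are $\rho_j=(L_j\xleftarrow{l_j}K_j\xrightarrow{r_j}R_j,\,ac_j)$,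 $j=1,2$, with $l_j,r_j\in\mathcal M$ and $ac_j$ an arbitrary nested condition over $L_j$. A transformation $t_j\colon G\Rightarrow_{\rho_j,m_j}H_j$ consists of a match $m_j\colon L_j\to G$ with $m_j\models ac_j$ and a double pushout with lower span $G\xleftarrow{g_j}D_j\xrightarrow{h_j}H_j$; it is *ac-disregarding* if $m_j\models ac_j$ is not required. The transformation $t_1$ *causes a conflict for* $t_2$ if there is no $d_1\colon L_2\to D_1$ with $g_1\circ d_1=m_2$, or there is one and $h_1\circ d_1\not\models ac_2$. The pair $(t_1,t_2)$ is *parallel dependent* if it is not parallel independent, where it is *parallel independent* if there are $d_1\colon L_2\to D_1$ and $d_2\colon L_1\to D_2$ with $g_1\circ d_1=m_2$, $g_2\circ d_2=m_1$, $h_1\circ d_1\models ac_2$ and $h_2\circ d_2\models ac_1$. *Proto-essences.* For $l\colon K\to L$ in $\mathcal M$ and a cospan $L\xrightarrow{m}X\xleftarrow{e}P$, let $L\xleftarrow{a}A\xrightarrow{b}P$ be the pullback of $(m,e)$, let $k\colon A'\to A$ and $A'\to K$ be the pullback of $l$ along $a$, and let $B\to C$, with boundary $\beta\colon B\to A'$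 and $c\colon C\to A$, be the initial pushout over $k$. Then $\mathrm{ess}_l(m,e):=(a\circ c,\,b\circ c)$, taken together with this diagram; it is *trivial* if $C\cong\bot$. Consider a path $L_2=P_0\xrightarrow{p_1}P_1\to\dots\xrightarrow{p_n}P_n$ in the tree of $ac_2$, starting at the root, where $P_n$ is a leaf or $n=0$, and a cospan $(e_{L_1}\colon L_1\to X,\ e_{P_n}\colon P_n\to X)\in\mathcal E'$ with $e_{P_n}\in\mathcal M$ if $n\ge1$. Put $e_{P_i}=e_{P_n}\circ p_n\circ\dots\circ p_{i+1}$. The *proto-essence by deletion* determined by these data is $\mathrm{ess}_{l_1}(e_{L_1},e_{P_i})$ for the smallest $i\in\{0,\dots,n\}$ for which this is nontrivial, and for $i=n$ if there is none. A *proto-essence by insertion* is defined in the same way for the inverse rule, that is, with $r_1\colon K_1\to R_1$ and cospans $(e_{R_1},e_{P_n})\in\mathcal E'$, with $i$ and $n$ restricted to values $\ge1$. The *shift* over $\rho_1$ of a proto-essence by insertion at $P_i$ is the span $L_1\xleftarrow{l_1}K_1\leftarrow A'\xleftarrow{\beta}B\xrightarrow{\beta}A'\xrightarrow{b'}P_i'$,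 where $A'\xrightarrow{b'}P_i'\xrightarrow{x}P_i$ is a pushout complement of $A'\xrightarrow{k}A\xrightarrow{b}P_i$; it comes with a morphism $p'\colon L_2\to P_i'$ whose composite with $x\colon P_i'\to P_i$ is the path $p_i\circ\dots\circ p_1$. *Embeddings.* To a proto-essence by deletion at $P=P_i$ belong the span $L_1\xleftarrow{a}A\xrightarrow{b}P$ and the path $p=p_i\circ\dots\circ p_1\colon L_2\to P$; to a shifted proto-essence by insertion, with $P=P_i'$, belong the span $L_1\leftarrow A'\xrightarrow{b'}P$ and $p=p'\colon L_2\to P$. Such an essence is *embedded* in a pair of (possibly ac-disregarding) transformations of $G$ with matches $m_1,m_2$ if there is $m\colon P\to G$ with $m\circ p=m_2$ such that the span is a pullback of $(m_1,m)$; in this case $(m_1,m)$ is an embedding. *Disabling essences.* $\mathrm{Ess}(\rho_1,\rho_2)$ consists of - the nontrivial proto-essences by deletion at an object $P$ that is existentially bound in $ac_2$ or is the root $L_2$, and - the shifts of the nontrivial proto-essences by insertion at an object that is universally bound in $ac_2$, in both cases provided that, with $P$ and $p$ as above, there are a cospan $(e_1\colon L_1\to Y,\ e_2\colon P\to Y)\in\mathcal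 E'$ and ac-disregarding transformations of $Y$ via $\rho_1$ and $\rho_2$ with matches $e_1$ and $e_2\circ p$ in which the essence is embedded by $(e_1,e_2)$. **Theorem.** Let $t_1$ and $t_2$ be transformations of an object $G$ via rules $\rho_1$ and $\rho_2$ with arbitrary nested application conditions. If $t_1$ causes a conflict for $t_2$, then some disabling essence in $\mathrm{Ess}(\rho_1,\rho_2)$ is embedded in $(t_1,t_2)$. Consequently, if $(t_1,t_2)$ is parallel dependent, then some disabling essence in $\mathrm{Ess}(\rho_1,\rho_2)$ is embedded in $(t_1,t_2)$ or some disabling essence in $\mathrm{Ess}(\rho_2,\rho_1)$ is embedded in $(t_2,t_1)$. -/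

import Mathlib

open CategoryTheory CategoryTheory.Limits

universe w v u

namespace GraphTransformation

variable {C : Type u} [Category.{v} C]

/-! ### The ambient category -/

/-- `(C, M)` is an adhesive HLR category. -/
structure IsAdhesiveHLR (M : MorphismProperty C) : Prop where
  mono : ∀ {X Y : C} (f : X ⟶ Y), M f → Mono f
  iso : ∀ {X Y : C} (f : X ⟶ Y), IsIso f → M f
  comp : ∀ {X Y Z : C} (f : X ⟶ Y) (g : Y ⟶ Z), M f → M g → M (f ≫ g)
  decomp : ∀ {X Y Z : C} (f : X ⟶ Y) (g : Y ⟶ Z), M (f ≫ g) → M g → M f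
  hasPushout : ∀ {X Y Z : C} (f : X ⟶ Y) (g : X ⟶ Z), M f → HasPushout f g
  hasPullback : ∀ {X Y Z : C} (f : X ⟶ Z) (g : Y ⟶ Z), M f → HasPullback f g
  stablePushout : M.IsStableUnderCobaseChange
  stablePullback : M.IsStableUnderBaseChange
  vanKampen : ∀ {W X Y Z : C} {f : W ⟶ X} {g : W ⟶ Y} {h : X ⟶ Z} {i : Y ⟶ Z}
    (H : IsPushout f g h i), M f → H.IsVanKampen

/-- There is an initial object all of whose outgoing morphisms belong to `M`. -/
def HasMInitial (M : MorphismProperty C) : Prop :=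
  ∃ I : C, Nonempty (IsInitial I) ∧ ∀ (A : C) (f : I ⟶ A), M f

/-- The square
```
  B --x--> X
  |b       |c
  A --f--> A'
```
is an initial pushout over `f`, with boundary `b` and context `X`. -/
structure IsInitialPushout (M : MorphismProperty C) {A A' B X : C}
    (f : A ⟶ A') (b : B ⟶ A) (x : B ⟶ X) (c : X ⟶ A') : Prop where
  isPushout : IsPushout b x f c
  boundary_mem : M b
  initial : ∀ {D E : C} (d : D ⟶ A) (y : D ⟶ E) (e : E ⟶ A'), M d → IsPushout d y f e →
    ∃! s : (B ⟶ D) × (X ⟶ E), M s.1 ∧ M s.2 ∧ s.1 ≫ d = b ∧ s.2 ≫ e = c ∧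
      IsPushout s.1 x y s.2

/-- Every `M`-morphism has an initial pushout. -/
def HasInitialPushouts (M : MorphismProperty C) : Prop :=
  ∀ {A A' : C} (f : A ⟶ A'), M f →
    ∃ (B X : C) (b : B ⟶ A) (x : B ⟶ X) (c : X ⟶ A'), IsInitialPushout M f b x c

/-- A class of cospans (pairs of morphisms with common codomain). -/
abbrev CospanClass (C : Type u) [Category.{v} C] :=
  ∀ ⦃X Y Z : C⦄, (X ⟶ Z) → (Y ⟶ Z) → Prop

/-- Every cospan factors, uniquely up to isomorphism, as a cospan in `E'` followed by an
`M`-morphism. -/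
structure HasPairFactorization (E' : CospanClass C) (M : MorphismProperty C) : Prop where
  exists_factor : ∀ {X Y Z : C} (f : X ⟶ Z) (g : Y ⟶ Z),
    ∃ (K : C) (e₁ : X ⟶ K) (e₂ : Y ⟶ K) (m : K ⟶ Z),
      E' e₁ e₂ ∧ M m ∧ e₁ ≫ m = f ∧ e₂ ≫ m = g
  unique : ∀ {X Y Z K K' : C} (e₁ : X ⟶ K) (e₂ : Y ⟶ K) (m : K ⟶ Z)
    (e₁' : X ⟶ K') (e₂' : Y ⟶ K') (m' : K' ⟶ Z),
    E' e₁ e₂ → M m → E' e₁' e₂' → M m' → e₁ ≫ m = e₁' ≫ m' → e₂ ≫ m = e₂' ≫ m' →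
    ∃ φ : K ≅ K', e₁ ≫ φ.hom = e₁' ∧ e₂ ≫ φ.hom = e₂' ∧ φ.hom ≫ m' = m

/-! ### Nested conditions -/

/-- Nested conditions over an object. Boolean combinations are generated by negation and by
conjunctions and disjunctions over arbitrary index types. -/
inductive NestedCondition (C : Type u) [Category.{v} C] : C → Type (max u v (w + 1))
  | tru (P : C) : NestedCondition C P
  | neg {P : C} (c : NestedCondition C P) : NestedCondition C P
  | conj {P : C} {ι : Type w} (c : ι → NestedCondition C P) : NestedCondition C P
  | disj {P : C} {ι : Type w} (c : ι → NestedCondition C P) : NestedCondition C P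
  | ex {P Q : C} (p : P ⟶ Q) (d : NestedCondition C Q) : NestedCondition C P

namespace NestedCondition

/-- `∀ (p, d)` abbreviates `¬ ∃ (p, ¬ d)`. -/
def all {P Q : C} (p : P ⟶ Q) (d : NestedCondition.{w} C Q) : NestedCondition.{w} C P :=
  neg (ex p (neg d))

/-- `c.Sat M q`: the morphism `q` satisfies the condition `c`. -/
def Sat (M : MorphismProperty C) {G : C} :
    {P : C} → NestedCondition.{w} C P → (P ⟶ G) → Prop
  | _, tru _, _ => True
  | _, neg c, q => ¬ c.Sat M q
  | _, conj c, q => ∀ i, (c i).Sat M q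
  | _, disj c, q => ∃ i, (c i).Sat M q
  | _, @ex _ _ _ Q p d, q => ∃ q₁ : Q ⟶ G, M q₁ ∧ p ≫ q₁ = q ∧ d.Sat M q₁

/-- All morphisms appearing in the condition belong to `M`. -/
def AllMem (M : MorphismProperty C) : {P : C} → NestedCondition.{w} C P → Prop
  | _, tru _ => True
  | _, neg c => c.AllMem M
  | _, conj c => ∀ i, (c i).AllMem M
  | _, disj c => ∀ i, (c i).AllMem M
  | _, ex p d => M p ∧ d.AllMem M

/-- `M`-normal form: all morphisms appearing in the condition belong to `M`, except possibly those
starting at the object over which the condition is defined. -/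
def IsNormal (M : MorphismProperty C) : {P : C} → NestedCondition.{w} C P → Prop
  | _, tru _ => True
  | _, neg c => c.IsNormal M
  | _, conj c => ∀ i, (c i).IsNormal M
  | _, disj c => ∀ i, (c i).IsNormal M
  | _, ex _ d => d.AllMem M

end NestedCondition

/-- The two ways in which an object of a condition can be bound. -/
inductive Binding
  | existential
  | universal

/-- Negation exchanges the two kinds of binding. -/
def Binding.flip : Binding → Binding
  | .existential => .universal
  | .universal => .existential

/-- The edges leaving the root of the tree of a condition. `Edge β c p d β'`: the condition `c` has
a quantified subcondition with morphism `p` and body `d` that is not in the scope of another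
quantifier of `c`. Here `β` is `existential` if `c` itself stands under an even number of negations
and `universal` otherwise, and `β'` tells how the target of `p` is bound once all negations have
been pushed inward. -/
inductive Edge : Binding → {P : C} → NestedCondition.{w} C P → {Q : C} → (P ⟶ Q) →
    NestedCondition.{w} C Q → Binding → Prop
  | ex (β : Binding) {P Q : C} (p : P ⟶ Q) (d : NestedCondition.{w} C Q) :
      Edge β (.ex p d) p d β
  | neg {β β' : Binding} {P Q : C} {c : NestedCondition.{w} C P} {p : P ⟶ Q}
      {d : NestedCondition.{w} C Q} : Edge β.flip c p d β' → Edge β (.neg c) p d β'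
  | conj {β β' : Binding} {P Q : C} {ι : Type w} {c : ι → NestedCondition.{w} C P} {p : P ⟶ Q}
      {d : NestedCondition.{w} C Q} (i : ι) : Edge β (c i) p d β' → Edge β (.conj c) p d β'
  | disj {β β' : Binding} {P Q : C} {ι : Type w} {c : ι → NestedCondition.{w} C P} {p : P ⟶ Q}
      {d : NestedCondition.{w} C Q} (i : ι) : Edge β (c i) p d β' → Edge β (.disj c) p d β'

/-- The node carrying the condition `d` has no outgoing edge. -/
def NestedCondition.IsLeaf {P : C} (d : NestedCondition.{w} C P) : Prop :=
  ∀ (β β' : Binding) (Q : C) (p : P ⟶ Q) (e : NestedCondition.{w} C Q), ¬ Edge β d p e β'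

/-- Paths in the tree of `c` from the root to a node; a node is an object `Q` together with the
subcondition `d` over `Q` standing there and the binding of `Q` (conventionally `existential` for
the root). -/
inductive TreePath {P : C} (c : NestedCondition.{w} C P) :
    (Q : C) → NestedCondition.{w} C Q → Binding → Type (max u v (w + 1))
  | nil : TreePath c P c .existential
  | snoc {Q R : C} {d : NestedCondition.{w} C Q} {e : NestedCondition.{w} C R} {β β' : Binding}
      (π : TreePath c Q d β) (p : Q ⟶ R) (h : Edge β d p e β') : TreePath c R e β'

namespace TreePath

variable {P : C} {c : NestedCondition.{w} C P}

/-- The composite of the morphisms along a path. -/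
def map : {Q : C} → {d : NestedCondition.{w} C Q} → {β : Binding} → TreePath c Q d β → (P ⟶ Q)
  | _, _, _, nil => 𝟙 P
  | _, _, _, snoc π p _ => π.map ≫ p

/-- The number of edges of a path, i.e. the level of its end node. -/
def length : {Q : C} → {d : NestedCondition.{w} C Q} → {β : Binding} → TreePath c Q d β → ℕ
  | _, _, _, nil => 0
  | _, _, _, snoc π _ _ => π.length + 1

end TreePath

/-! ### Rules and transformations -/

/-- A rule `L ↩ K ↪ R` with an application condition over `L` in `M`-normal form. -/
structure Rule (M : MorphismProperty C) where
  L : C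
  K : C
  R : C
  l : K ⟶ L
  r : K ⟶ R
  l_mem : M l
  r_mem : M r
  ac : NestedCondition.{w} C L
  ac_normal : ac.IsNormal M

variable {M : MorphismProperty C}

/-- An ac-disregarding transformation of `G` via `ρ`: a match together with a double pushout. -/
structure PreTransformation (ρ : Rule.{w} M) (G : C) where
  m : ρ.L ⟶ G
  D : C
  H : C
  k : ρ.K ⟶ D
  g : D ⟶ G
  h : D ⟶ H
  n : ρ.R ⟶ H
  left : IsPushout ρ.l k m g
  right : IsPushout ρ.r k n h

/-- A transformation of `G` via `ρ`: the match satisfies the application condition. -/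
structure Transformation (ρ : Rule.{w} M) (G : C) extends PreTransformation ρ G where
  sat : ρ.ac.Sat M m

/-- `t₁` and `t₂` are parallel independent. -/
def ParallelIndependent {ρ₁ ρ₂ : Rule.{w} M} {G : C}
    (t₁ : Transformation ρ₁ G) (t₂ : Transformation ρ₂ G) : Prop :=
  ∃ (d₁ : ρ₂.L ⟶ t₁.D) (d₂ : ρ₁.L ⟶ t₂.D), d₁ ≫ t₁.g = t₂.m ∧ d₂ ≫ t₂.g = t₁.m ∧
    ρ₂.ac.Sat M (d₁ ≫ t₁.h) ∧ ρ₁.ac.Sat M (d₂ ≫ t₂.h)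

/-- `t₁` causes a conflict for `t₂`: there is no morphism `d₁ : L₂ ⟶ D₁` with `d₁ ≫ g₁ = m₂`, or
`d₁ ≫ h₁` violates the application condition of `ρ₂`. -/
def CausesConflict {ρ₁ ρ₂ : Rule.{w} M} {G : C}
    (t₁ : Transformation ρ₁ G) (t₂ : Transformation ρ₂ G) : Prop :=
  (¬ ∃ d₁ : ρ₂.L ⟶ t₁.D, d₁ ≫ t₁.g = t₂.m) ∨
    ∃ d₁ : ρ₂.L ⟶ t₁.D, d₁ ≫ t₁.g = t₂.m ∧ ¬ ρ₂.ac.Sat M (d₁ ≫ t₁.h)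

/-! ### Rule overlaps and their embeddings -/

/-- An overlap of two rules. -/
structure RuleOverlap (ρ₁ ρ₂ : Rule.{w} M) where
  A : C
  Pj : C
  Pi : C
  bj : A ⟶ Pj
  bi : A ⟶ Pi
  pL₁ : ρ₁.L ⟶ Pj
  pL₂ : ρ₂.L ⟶ Pi

/-- `(m₁, m₂)` is an embedding of the rule overlap in the pair `(t₁, t₂)` of (ac-disregarding)
transformations. -/
structure RuleOverlap.IsEmbedding {ρ₁ ρ₂ : Rule.{w} M} (ro : RuleOverlap ρ₁ ρ₂) {G : C}
    (t₁ : PreTransformation ρ₁ G) (t₂ : PreTransformation ρ₂ G)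
    (m₁ : ro.Pj ⟶ G) (m₂ : ro.Pi ⟶ G) : Prop where
  match₁ : ro.pL₁ ≫ m₁ = t₁.m
  match₂ : ro.pL₂ ≫ m₂ = t₂.m
  isPullback : IsPullback ro.bj ro.bi m₁ m₂

/-- The rule overlap is embedded in `(t₁, t₂)`. -/
def RuleOverlap.EmbeddedIn {ρ₁ ρ₂ : Rule.{w} M} (ro : RuleOverlap ρ₁ ρ₂) {G : C}
    (t₁ : PreTransformation ρ₁ G) (t₂ : PreTransformation ρ₂ G) : Prop :=
  ∃ (m₁ : ro.Pj ⟶ G) (m₂ : ro.Pi ⟶ G), ro.IsEmbedding t₁ t₂ m₁ m₂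

/-- An essence, i.e. the span `L₁ ⟵ ob ⟶ P` given by `c ≫ a` and `c ≫ b`, recorded together with
the span `L₁ ⟵ A ⟶ P` from which it arises and the morphism `p : L₂ ⟶ P`. -/
structure Essence (ρ₁ ρ₂ : Rule.{w} M) where
  ob : C
  A : C
  P : C
  c : ob ⟶ A
  a : A ⟶ ρ₁.L
  b : A ⟶ P
  p : ρ₂.L ⟶ P

/-- The rule overlap `(a : A ⟶ L₁, b : A ⟶ P, 𝟙 L₁, p : L₂ ⟶ P)` of an essence. -/
def Essence.toOverlap {ρ₁ ρ₂ : Rule.{w} M} (ε : Essence ρ₁ ρ₂) : RuleOverlap ρ₁ ρ₂ where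
  A := ε.A
  Pj := ρ₁.L
  Pi := ε.P
  bj := ε.a
  bi := ε.b
  pL₁ := 𝟙 ρ₁.L
  pL₂ := ε.p

/-! ### Proto-essences -/

/-- The part of the proto-essence construction that lies over a span `L ⟵ A ⟶ P`:
```
  B --j--> E
  |β       |c
  A'--k--> A --b--> P
  |u       |a
  K --l--> L
```
The lower square is a pullback, the upper one an initial pushout over `k`. The proto-essence is
the span `(c ≫ a, c ≫ b)`. -/
structure EssenceDiagram (M : MorphismProperty C) {K L : C} (l : K ⟶ L) (P : C) where
  A : C
  A' : C
  B : C
  E : C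
  a : A ⟶ L
  b : A ⟶ P
  k : A' ⟶ A
  u : A' ⟶ K
  β : B ⟶ A'
  j : B ⟶ E
  c : E ⟶ A
  isPullback : IsPullback k u a l
  isInitialPushout : IsInitialPushout M k β j c

/-- The diagram is (a choice of) the proto-essence for `(m₁, m₂)` under `l`. -/
def EssenceDiagram.IsEssenceOf {K L P : C} {l : K ⟶ L} (δ : EssenceDiagram M l P) {G : C}
    (m₁ : L ⟶ G) (m₂ : P ⟶ G) : Prop :=
  IsPullback δ.a δ.b m₁ m₂

/-- The proto-essence is the trivial span `(!, !)` out of the initial object. -/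
def EssenceDiagram.IsTrivial {K L P : C} {l : K ⟶ L} (δ : EssenceDiagram M l P) : Prop :=
  Nonempty (IsInitial δ.E)

/-- A proto-essence together with the node `P` (and the path leading to it) in the tree of the
condition `c` to which it refers. -/
structure ProtoEssence (M : MorphismProperty C) {K L : C} (l : K ⟶ L) {P₀ : C}
    (c : NestedCondition.{w} C P₀) where
  P : C
  cond : NestedCondition.{w} C P
  binding : Binding
  path : TreePath c P cond binding
  diagram : EssenceDiagram M l P

/-- `IsProtoEssenceAt base l eL π e pe`: for the node `Pᵢ` at the end of the path `π`, with
`e : Pᵢ ⟶ X`, `pe` is the value at that node of the recursion along `π` starting at level `base`: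
at each level one keeps the value of the preceding level if this is nontrivial, and otherwise takes
the proto-essence for `(eL, e)` under `l`. -/
inductive IsProtoEssenceAt (base : ℕ) {K L X P₀ : C} (l : K ⟶ L) {c : NestedCondition.{w} C P₀}
    (eL : L ⟶ X) : {Q : C} → {d : NestedCondition.{w} C Q} → {β : Binding} →
      TreePath c Q d β → (Q ⟶ X) → ProtoEssence M l c → Prop
  | start {Q : C} {d : NestedCondition.{w} C Q} {β : Binding} (π : TreePath c Q d β) (e : Q ⟶ X)
      (δ : EssenceDiagram M l Q) (hπ : π.length = base) (hδ : δ.IsEssenceOf eL e) :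
      IsProtoEssenceAt base l eL π e ⟨Q, d, β, π, δ⟩
  | keep {Q R : C} {d : NestedCondition.{w} C Q} {d' : NestedCondition.{w} C R} {β β' : Binding}
      (π : TreePath c Q d β) (p : Q ⟶ R) (h : Edge β d p d' β') (e : R ⟶ X)
      (pe : ProtoEssence M l c) (hpe : IsProtoEssenceAt base l eL π (p ≫ e) pe)
      (hne : ¬ pe.diagram.IsTrivial) :
      IsProtoEssenceAt base l eL (π.snoc p h) e pe
  | next {Q R : C} {d : NestedCondition.{w} C Q} {d' : NestedCondition.{w} C R} {β β' : Binding}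
      (π : TreePath c Q d β) (p : Q ⟶ R) (h : Edge β d p d' β') (e : R ⟶ X)
      (pe : ProtoEssence M l c) (hpe : IsProtoEssenceAt base l eL π (p ≫ e) pe)
      (ht : pe.diagram.IsTrivial) (δ : EssenceDiagram M l R) (hδ : δ.IsEssenceOf eL e) :
      IsProtoEssenceAt base l eL (π.snoc p h) e ⟨R, d', β', π.snoc p h, δ⟩

/-- The proto-essences obtained from all overlaps `(eL : L ⟶ X, e : Pₙ ⟶ X)` in `E'`, where `Pₙ`
is the root or a leaf of the tree of `c`, and `e` is in `M` unless `Pₙ` is the root. -/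
def protoEssences (E' : CospanClass C) (base : ℕ) {K L P₀ : C} (l : K ⟶ L)
    (c : NestedCondition.{w} C P₀) : Set (ProtoEssence M l c) :=
  {pe | ∃ (Q : C) (d : NestedCondition.{w} C Q) (β : Binding) (π : TreePath c Q d β) (X : C)
    (eL : L ⟶ X) (e : Q ⟶ X), (π.length = 0 ∨ d.IsLeaf) ∧ E' eL e ∧ (π.length ≠ 0 → M e) ∧
      IsProtoEssenceAt base l eL π e pe}

/-- The proto-essences by deletion of `ρ₁` in `ρ₂`. -/
def protoEssencesByDeletion (E' : CospanClass C) (ρ₁ ρ₂ : Rule.{w} M) :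
    Set (ProtoEssence M ρ₁.l ρ₂.ac) :=
  protoEssences E' 0 ρ₁.l ρ₂.ac

/-- The proto-essences by insertion of `ρ₁` in `ρ₂`: the same for the inverse of `ρ₁`, the
recursion starting at level `1`. -/
def protoEssencesByInsertion (E' : CospanClass C) (ρ₁ ρ₂ : Rule.{w} M) :
    Set (ProtoEssence M ρ₁.r ρ₂.ac) :=
  protoEssences E' 1 ρ₁.r ρ₂.ac

/-! ### Disabling essences -/

/-- A proto-essence by deletion as an essence. -/
def ProtoEssence.toEssence {ρ₁ ρ₂ : Rule.{w} M} (pe : ProtoEssence M ρ₁.l ρ₂.ac) :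
    Essence ρ₁ ρ₂ where
  ob := pe.diagram.E
  A := pe.diagram.A
  P := pe.P
  c := pe.diagram.c
  a := pe.diagram.a
  b := pe.diagram.b
  p := pe.path.map

/-- `ε` is the shift over `ρ₁` of the proto-essence by insertion `pe`. With the notation of the
diagram of `pe` (for the morphism `r₁ : K₁ ⟶ R₁`), `ε` is the span
`L₁ ⟵ K₁ ⟵ A' ⟵ B ⟶ A' ⟶ P'`, where `P'` is a pushout complement of `k : A' ⟶ A` and `b : A ⟶ P`,
and `L₂ ⟶ P'` is a factorization of the path `L₂ ⟶ P` through `P' ⟶ P`. -/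
inductive IsShift {ρ₁ ρ₂ : Rule.{w} M} (pe : ProtoEssence M ρ₁.r ρ₂.ac) : Essence ρ₁ ρ₂ → Prop
  | mk (P' : C) (b' : pe.diagram.A' ⟶ P') (i : P' ⟶ pe.P) (p' : ρ₂.L ⟶ P')
      (hP' : IsPushout pe.diagram.k b' pe.diagram.b i) (hp' : p' ≫ i = pe.path.map) :
      IsShift pe
        { ob := pe.diagram.B
          A := pe.diagram.A'
          P := P'
          c := pe.diagram.β
          a := pe.diagram.u ≫ ρ₁.l
          b := b'
          p := p' }

/-- The essence is embedded in some pair of ac-disregarding transformations of an object `Y` whose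
matches are `e₁ : L₁ ⟶ Y` and `p ≫ e₂ : L₂ ⟶ P ⟶ Y` with `(e₁, e₂)` in `E'`. -/
def Essence.EmbedsInOverlap (E' : CospanClass C) {ρ₁ ρ₂ : Rule.{w} M} (ε : Essence ρ₁ ρ₂) : Prop :=
  ∃ (Y : C) (e₁ : ρ₁.L ⟶ Y) (e₂ : ε.P ⟶ Y) (s₁ : PreTransformation ρ₁ Y)
    (s₂ : PreTransformation ρ₂ Y), E' e₁ e₂ ∧ s₁.m = e₁ ∧ s₂.m = ε.p ≫ e₂ ∧
      ε.toOverlap.IsEmbedding s₁ s₂ e₁ e₂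

/-- The disabling essences by deletion of `ρ₁` in `ρ₂`. -/
def disablingEssencesByDeletion (E' : CospanClass C) (ρ₁ ρ₂ : Rule.{w} M) :
    Set (Essence ρ₁ ρ₂) :=
  {ε | ∃ pe ∈ protoEssencesByDeletion E' ρ₁ ρ₂, ε = pe.toEssence ∧ ε.EmbedsInOverlap E' ∧
    (pe.binding = .existential ∨ pe.path.length = 0) ∧ ¬ pe.diagram.IsTrivial}

/-- The disabling essences by insertion of `ρ₁` in `ρ₂`. -/
def disablingEssencesByInsertion (E' : CospanClass C) (ρ₁ ρ₂ : Rule.{w} M) :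
    Set (Essence ρ₁ ρ₂) :=
  {ε | ∃ pe ∈ protoEssencesByInsertion E' ρ₁ ρ₂, IsShift pe ε ∧ ε.EmbedsInOverlap E' ∧
    pe.binding = .universal ∧ ¬ pe.diagram.IsTrivial}

/-- The set `Ess(ρ₁, ρ₂)` of disabling essences of `ρ₁` in `ρ₂`. -/
def disablingEssences (E' : CospanClass C) (ρ₁ ρ₂ : Rule.{w} M) : Set (Essence ρ₁ ρ₂) :=
  disablingEssencesByDeletion E' ρ₁ ρ₂ ∪ disablingEssencesByInsertion E' ρ₁ ρ₂

end GraphTransformation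

namespace GraphTransformation

variable {C : Type u} [Category.{v} C] {M : MorphismProperty C} {E' : CospanClass C}

/-! ### Pushouts along `M`-morphisms -/

/-! The bridge between essences and transformations is `EssenceDiagram.isTrivial_iff`: the essence
of `(m, q)` is trivial exactly when `q` factors through the pushout complement `D`. So if `m₂` does
not factor through `D₁`, the essence at the root is nontrivial.

Otherwise let `d₁` be a factorization with `d₁ ≫ g₁ ⊨ ac₂` and `d₁ ≫ h₁ ⊭ ac₂`. Descending through
`ac₂` (`isBlocked_of_sat`), a witness in one of `G`, `H₁` that lies in `D₁` can be carried over to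
the other object, where the body must then fail; each negation exchanges the roles of `G` and `H₁`.
The descent ends at a witness that does not factor through `D₁`: at an existentially bound node with
values in `G` (something was deleted), or at a universally bound one with values in `H₁` (something
was inserted). All earlier nodes factor through `D₁` and give trivial essences, so the recursion
defining proto-essences stops exactly at this node (`IsBlocked.exists_protoEssence`).

That definition asks for an `E'`-overlap with a leaf, although the witness may not extend to a leaf
inside the given object. `mem_protoEssences` glues a leaf on by a pushout; the pullbacks involved do
not notice this enlargement, because it is monic. Deletion essences embed directly. For insertion,
the van Kampen property, applied to the right-hand pushout of `t₁` pulled back along the witness,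
produces the pushout complement used by the shift, and pasting pullbacks embeds the result in `G`.
-/

theorem isPullback_comp_mono {A X Y Z W : C} {a : A ⟶ X} {b : A ⟶ Y} {f : X ⟶ Z} {g : Y ⟶ Z}
    (H : IsPullback a b f g) (x : Z ⟶ W) [Mono x] : IsPullback a b (f ≫ x) (g ≫ x) :=
  ⟨⟨by rw [← Category.assoc, H.w, Category.assoc]⟩,
    ⟨PullbackCone.IsLimit.mk _
      (fun s => H.lift s.fst s.snd ((cancel_mono x).1 (by simpa using s.condition)))
      (fun s => H.lift_fst _ _ _) (fun s => H.lift_snd _ _ _)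
      (fun s m h₁ h₂ => H.hom_ext (by simpa using h₁) (by simpa using h₂))⟩⟩

theorem isPullback_of_comp_mono {A X Y Z W : C} {a : A ⟶ X} {b : A ⟶ Y} {f : X ⟶ Z} {g : Y ⟶ Z}
    (x : Z ⟶ W) [Mono x] (H : IsPullback a b (f ≫ x) (g ≫ x)) : IsPullback a b f g :=
  ⟨⟨(cancel_mono x).1 (by simpa using H.w)⟩,
    ⟨PullbackCone.IsLimit.mk _
      (fun s => H.lift s.fst s.snd (by rw [← Category.assoc, s.condition, Category.assoc]))
      (fun s => H.lift_fst _ _ _) (fun s => H.lift_snd _ _ _)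
      (fun s m h₁ h₂ => H.hom_ext (by simpa using h₁) (by simpa using h₂))⟩⟩

theorem isPullback_id_of_mono {X Y Z : C} {f : X ⟶ Z} {e : X ⟶ Y} {y : Y ⟶ Z} [Mono y]
    (h : e ≫ y = f) : IsPullback (𝟙 X) e f y := by
  subst h
  simpa using isPullback_comp_mono (IsPullback.id_horiz e) y

namespace IsAdhesiveHLR

theorem mem_of_isPushout (hM : IsAdhesiveHLR M) {K L D G : C} {l : K ⟶ L} {k : K ⟶ D} {m : L ⟶ G}
    {g : D ⟶ G} (H : IsPushout l k m g) (hl : M l) : M g :=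
  hM.stablePushout.of_isPushout H.flip hl

theorem mem_of_isPullback (hM : IsAdhesiveHLR M) {K L D G : C} {l : K ⟶ L} {k : K ⟶ D} {m : L ⟶ G}
    {g : D ⟶ G} (H : IsPullback l k m g) (hg : M g) : M l :=
  hM.stablePullback.of_isPullback H.flip hg

theorem isPullback (hM : IsAdhesiveHLR M) {K L D G : C} {l : K ⟶ L} {k : K ⟶ D} {m : L ⟶ G}
    {g : D ⟶ G} (H : IsPushout l k m g) (hl : M l) : IsPullback l k m g :=
  have := hM.mono _ hl
  (hM.vanKampen H hl).isPullback_of_mono_left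

/-- A pushout along an `M`-morphism is stable under pullback. -/
theorem exists_isPushout_of_isPullback (hM : IsAdhesiveHLR M) {K L D G : C} {l : K ⟶ L}
    {k : K ⟶ D} {m : L ⟶ G} {g : D ⟶ G} (H : IsPushout l k m g) (hl : M l) {A P A' P' : C}
    {a : A ⟶ L} {b : A ⟶ P} {q : P ⟶ G} {k' : A' ⟶ A} {u : A' ⟶ K} {i : P' ⟶ P} {d : P' ⟶ D}
    (h₁ : IsPullback a b m q) (h₂ : IsPullback k' u a l) (h₃ : IsPullback i d q g) :
    ∃ b' : A' ⟶ P', IsPushout k' b' b i ∧ IsPullback b' u d k := by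
  -- Cube over `H`: pasting and then cancelling `h₃` makes the second back face a pullback, so van
  -- Kampen applies to the top face.
  have h₄ : IsPullback (k' ≫ b) u q (k ≫ g) := H.w ▸ h₂.paste_horiz h₁.flip
  have h₅ := IsPullback.of_right' h₄ h₃
  exact ⟨_, (hM.vanKampen H hl _ _ _ _ _ _ _ _ h₂ h₅ h₁.flip.toCommSq h₃.toCommSq
    ⟨by simp⟩).2 ⟨h₁.flip, h₃⟩, h₅⟩

end IsAdhesiveHLR

/-! ### Triviality of essences -/

section Trivial

variable {K L D G P : C} {l : K ⟶ L} {k : K ⟶ D} {m : L ⟶ G} {g : D ⟶ G}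

/-- Strictness of the initial object is not needed: `j` is monic as a pullback of an `M`-morphism
and is split by the map out of the initial object `E`. Hence `j` is invertible, and so is its
pushout `k`. -/
theorem EssenceDiagram.isIso_of_isTrivial (hM : IsAdhesiveHLR M) (hI : HasMInitial M) (hl : M l)
    {δ : EssenceDiagram M l P} (ht : δ.IsTrivial) : IsIso δ.k := by
  obtain ⟨I, ⟨hI₀⟩, -⟩ := hI
  obtain ⟨hE⟩ := ht
  have hj : M δ.j := hM.mem_of_isPullback
    (hM.isPullback δ.isInitialPushout.isPushout δ.isInitialPushout.boundary_mem).flip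
    (hM.mem_of_isPullback δ.isPullback hl)
  have := hM.mono _ hj
  have : IsIso δ.j := by
    have h : hE.to δ.B ≫ δ.j = 𝟙 δ.E := hE.hom_ext _ _
    exact ⟨hE.to δ.B, by rw [← cancel_mono δ.j, Category.assoc, h]; simp, h⟩
  exact δ.isInitialPushout.isPushout.isIso_inl_of_isIso

/-- Over an isomorphism the identity of the `M`-initial object gives a competing pushout square;
initiality then yields a monomorphism from `E` into the initial object, which must be invertible. -/
theorem EssenceDiagram.isTrivial_of_isIso (hM : IsAdhesiveHLR M) (hI : HasMInitial M)
    {δ : EssenceDiagram M l P} (hk : IsIso δ.k) : δ.IsTrivial := by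
  obtain ⟨I, ⟨hI₀⟩, hI₁⟩ := hI
  have sq : IsPushout (hI₀.to δ.A') (𝟙 I) δ.k (hI₀.to δ.A) :=
    IsPushout.of_vert_isIso ⟨hI₀.hom_ext _ _⟩
  obtain ⟨⟨s, t⟩, ⟨-, ht, -⟩, -⟩ := δ.isInitialPushout.initial _ _ _ (hI₁ _ _) sq
  have := hM.mono _ ht
  have h : hI₀.to δ.E ≫ t = 𝟙 I := hI₀.hom_ext _ _
  have h' : t ≫ hI₀.to δ.E = 𝟙 δ.E := by
    dsimp only at *
    rw [← cancel_mono t, Category.assoc, h]; simp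
  exact ⟨hI₀.ofIso ⟨_, t, h, h'⟩⟩

/-- The essence of `(m, q)` is trivial iff `q` factors through the pushout complement. -/
theorem EssenceDiagram.isTrivial_iff (hM : IsAdhesiveHLR M) (hPB : HasPullbacks C)
    (hI : HasMInitial M) (H : IsPushout l k m g) (hl : M l) {δ : EssenceDiagram M l P} {q : P ⟶ G}
    (hδ : δ.IsEssenceOf m q) : δ.IsTrivial ↔ ∃ s : P ⟶ D, s ≫ g = q := by
  constructor
  · intro ht
    have := isIso_of_isTrivial hM hI hl ht
    -- Pulling `H` back along `q` exhibits the projection of the pullback of `(q, g)` to `P` as a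
    -- pushout of the isomorphism `δ.k`; inverting it gives the factorization.
    obtain ⟨b', hb, -⟩ := hM.exists_isPushout_of_isPullback H hl hδ δ.isPullback
      (IsPullback.of_hasPullback q g)
    have : IsIso (pullback.fst q g) := hb.isIso_inr_of_isIso
    exact ⟨inv (pullback.fst q g) ≫ pullback.snd q g, by
      rw [Category.assoc, ← pullback.condition, IsIso.inv_hom_id_assoc]⟩
  · rintro ⟨s, hs⟩
    have := hM.mono _ (hM.mem_of_isPullback δ.isPullback hl)
    have hw : δ.a ≫ m = (δ.b ≫ s) ≫ g := by rw [Category.assoc, hs]; exact hδ.w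
    -- `H` is also a pullback, so `δ.a` lifts to `K`; this provides a section of the monomorphism
    -- `δ.k`.
    have h : δ.isPullback.lift (𝟙 δ.A) ((hM.isPullback H hl).lift δ.a (δ.b ≫ s) hw) (by simp) ≫
        δ.k = 𝟙 δ.A := by simp
    exact isTrivial_of_isIso hM hI
      ⟨_, by rw [← cancel_mono δ.k, Category.assoc, h]; simp, h⟩

theorem exists_essenceDiagram (hM : IsAdhesiveHLR M) (hPB : HasPullbacks C)
    (hIPO : HasInitialPushouts M) (hl : M l) (m : L ⟶ G) (q : P ⟶ G) :
    ∃ δ : EssenceDiagram M l P, δ.IsEssenceOf m q := by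
  have h := IsPullback.of_hasPullback (pullback.fst m q) l
  obtain ⟨B, X, b, x, c, hX⟩ := hIPO _ (hM.mem_of_isPullback h hl)
  exact ⟨⟨_, _, _, _, _, _, _, _, _, _, _, h, hX⟩, IsPullback.of_hasPullback m q⟩

end Trivial

/-! ### Trees of conditions -/

/-- The polarity is only a label. A node that is not a leaf has an edge of some polarity, but a path
can be prolonged only by an edge matching the label of its end node. -/
theorem Edge.exists_rebind {β β' : Binding} {P Q : C} {c : NestedCondition.{w} C P} {p : P ⟶ Q}
    {d : NestedCondition.{w} C Q} (h : Edge β c p d β') : ∀ γ, ∃ γ', Edge γ c p d γ' := by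
  induction h with
  | ex β p d => exact fun γ => ⟨γ, .ex γ p d⟩
  | neg _ ih => exact fun γ => (ih γ.flip).imp fun _ h => .neg h
  | conj i _ ih => exact fun γ => (ih γ).imp fun _ h => .conj i h
  | disj i _ ih => exact fun γ => (ih γ).imp fun _ h => .disj i h

theorem Edge.mem {β β' : Binding} {P Q : C} {c : NestedCondition.{w} C P} {p : P ⟶ Q}
    {d : NestedCondition.{w} C Q} (h : Edge β c p d β') (hc : c.AllMem M) :
    M p ∧ d.AllMem M := by
  induction h with
  | ex β p d => exact hc
  | neg _ ih => exact ih hc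
  | conj i _ ih => exact ih (hc i)
  | disj i _ ih => exact ih (hc i)

theorem Edge.allMem {β β' : Binding} {P Q : C} {c : NestedCondition.{w} C P} {p : P ⟶ Q}
    {d : NestedCondition.{w} C Q} (h : Edge β c p d β') (hc : c.IsNormal M) : d.AllMem M := by
  induction h with
  | ex β p d => exact hc
  | neg _ ih => exact ih hc
  | conj i _ ih => exact ih (hc i)
  | disj i _ ih => exact ih (hc i)

theorem TreePath.allMem {P Q : C} {c : NestedCondition.{w} C P} (hc : c.IsNormal M)
    {d : NestedCondition.{w} C Q} {β : Binding} (π : TreePath c Q d β) (h : π.length ≠ 0) :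
    d.AllMem M := by
  induction π with
  | nil => exact absurd rfl h
  | snoc π p e ih =>
    cases π with
    | nil => exact e.allMem hc
    | snoc π' p' e' => exact (e.mem (ih (Nat.succ_ne_zero _))).2

/-! ### Proto-essences along paths -/

section Proto

variable {base : ℕ} {K L X Y P₀ Q : C} {l : K ⟶ L} {c : NestedCondition.{w} C P₀}
  {d : NestedCondition.{w} C Q} {β : Binding}

/-- The recursion sees the target object only through pullbacks of cospans, which monomorphisms out
of the target preserve and, in the next lemma, reflect. -/
theorem IsProtoEssenceAt.comp_mono {eL : L ⟶ X} {π : TreePath c Q d β} {e : Q ⟶ X}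
    {pe : ProtoEssence M l c} (h : IsProtoEssenceAt base l eL π e pe) (x : X ⟶ Y) [Mono x] :
    IsProtoEssenceAt base l (eL ≫ x) π (e ≫ x) pe := by
  induction h with
  | start π e δ hπ hδ => exact .start π _ δ hπ (isPullback_comp_mono hδ x)
  | keep π p h e pe _ hne ih => exact .keep π p h _ pe (by simpa using ih) hne
  | next π p h e pe _ ht δ hδ ih =>
    exact .next π p h _ pe (by simpa using ih) ht δ (isPullback_comp_mono hδ x)

theorem IsProtoEssenceAt.of_comp_mono {eL : L ⟶ X} {x : X ⟶ Y} [Mono x] {eL' : L ⟶ Y}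
    (hL : eL ≫ x = eL') {π : TreePath c Q d β} {e' : Q ⟶ Y} {pe : ProtoEssence M l c}
    (h : IsProtoEssenceAt base l eL' π e' pe) :
    ∀ e : Q ⟶ X, e ≫ x = e' → IsProtoEssenceAt base l eL π e pe := by
  subst hL
  induction h with
  | start π e' δ hπ hδ =>
    rintro e rfl
    exact .start π e δ hπ (isPullback_of_comp_mono x hδ)
  | keep π p h e' pe _ hne ih =>
    rintro e rfl
    exact .keep π p h _ pe (ih _ (by simp)) hne
  | next π p h e' pe _ ht δ hδ ih =>
    rintro e rfl
    exact .next π p h _ pe (ih _ (by simp)) ht δ (isPullback_of_comp_mono x hδ)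

/-- The path extends along `M`-morphisms to a leaf, and nontrivial proto-essences are kept. -/
def TreePath.ExtendsToLeaf (M : MorphismProperty C) (π : TreePath c Q d β) : Prop :=
  ∃ (R : C) (d' : NestedCondition.{w} C R) (β' : Binding) (π' : TreePath c R d' β') (m : Q ⟶ R),
    M m ∧ d'.IsLeaf ∧ ∀ {base : ℕ} {K L X : C} {l : K ⟶ L} (eL : L ⟶ X) (e : R ⟶ X)
      (pe : ProtoEssence M l c), ¬ pe.diagram.IsTrivial →
      IsProtoEssenceAt base l eL π (m ≫ e) pe → IsProtoEssenceAt base l eL π' e pe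

theorem TreePath.extendsToLeaf_of_edges (hM : IsAdhesiveHLR M) (π : TreePath c Q d β)
    (hd : d.AllMem M)
    (H : ∀ (γ γ' : Binding) (R : C) (p : Q ⟶ R) (e : NestedCondition.{w} C R), Edge γ d p e γ' →
      e.AllMem M → ∀ (β' : Binding) (π' : TreePath c R e β'), π'.ExtendsToLeaf M) :
    π.ExtendsToLeaf M := by
  by_cases hl : d.IsLeaf
  · exact ⟨Q, d, β, π, 𝟙 Q, hM.iso _ inferInstance, hl,
      fun eL e pe _ h => by simpa using h⟩
  · unfold NestedCondition.IsLeaf at hl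
    push Not at hl
    obtain ⟨γ, γ', R, p, e, h⟩ := hl
    obtain ⟨β', h'⟩ := h.exists_rebind β
    obtain ⟨hp, he⟩ := h.mem hd
    obtain ⟨S, d', β'', π', m, hm, hlf, hk⟩ := H _ _ _ _ _ h he _ (π.snoc p h')
    exact ⟨S, d', β'', π', p ≫ m, hM.comp _ _ hp hm, hlf, fun eL e pe hne hpe =>
      hk eL e pe hne (.keep π p h' _ pe (by simpa using hpe) hne)⟩

/-- Boolean combinations may be infinite, but conditions are well-founded, so every descent reaches
a leaf. Quantifying over edges suits the induction: Boolean constructors stay at the same node, and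
only `ex` moves to a new one. -/
theorem extendsToLeaf_of_edge (hM : IsAdhesiveHLR M) {S : C} (d₀ : NestedCondition.{w} C S) :
    ∀ (γ γ' : Binding) (R : C) (p : S ⟶ R) (e : NestedCondition.{w} C R), Edge γ d₀ p e γ' →
      e.AllMem M → ∀ (β' : Binding) (π' : TreePath c R e β'), π'.ExtendsToLeaf M := by
  induction d₀ with
  | tru P => intro _ _ _ _ _ h; cases h
  | neg d ih => intro _ _ _ _ _ h; cases h with | neg h => exact ih _ _ _ _ _ h
  | conj d ih => intro _ _ _ _ _ h; cases h with | conj i h => exact ih i _ _ _ _ _ h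
  | disj d ih => intro _ _ _ _ _ h; cases h with | disj i h => exact ih i _ _ _ _ _ h
  | ex p d ih =>
    intro _ _ _ _ _ h
    cases h
    exact fun he _ π' => π'.extendsToLeaf_of_edges hM he ih

theorem TreePath.extendsToLeaf (hM : IsAdhesiveHLR M) (π : TreePath c Q d β) (hd : d.AllMem M) :
    π.ExtendsToLeaf M :=
  π.extendsToLeaf_of_edges hM hd (extendsToLeaf_of_edge hM d)

/-- A nontrivial value of the recursion at a node of a concrete object is a proto-essence. -/
theorem mem_protoEssences (hM : IsAdhesiveHLR M) (hE : HasPairFactorization E' M)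
    (hc : c.IsNormal M) {G : C} {m : L ⟶ G} {q : Q ⟶ G} {π : TreePath c Q d β}
    {pe : ProtoEssence M l c} (hpe : IsProtoEssenceAt base l m π q pe)
    (hne : ¬ pe.diagram.IsTrivial) (hq : π.length = 0 ∨ M q) :
    pe ∈ protoEssences E' base l c := by
  by_cases h0 : π.length = 0
  · obtain ⟨X, e₁, e₂, x, he, hx, h₁, h₂⟩ := hE.exists_factor m q
    have := hM.mono _ hx
    exact ⟨Q, d, β, π, X, e₁, e₂, .inl h0, he, fun h => absurd h0 h, hpe.of_comp_mono h₁ _ h₂⟩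
  · have hq := hq.resolve_left h0
    obtain ⟨R, d', β', π', p, hp, hlf, hk⟩ := π.extendsToLeaf hM (π.allMem hc h0)
    -- Glue the leaf `R` to `G` along `Q`. Both coprojections lie in `M`: that of `G` because `p`
    -- does, that of `R` because `q` does. The latter gives the `M`-condition on the leaf component
    -- of the overlap.
    have := hM.hasPushout p q hp
    have H := IsPushout.of_hasPushout p q
    have hr := hM.mem_of_isPushout H hp
    have := hM.mono _ hr
    obtain ⟨X, e₁, e₂, x, he, hx, h₁, h₂⟩ := hE.exists_factor (m ≫ pushout.inr p q)
      (pushout.inl p q)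
    have := hM.mono _ hx
    refine ⟨R, d', β', π', X, e₁, e₂, .inr hlf, he,
      fun _ => hM.decomp e₂ x (h₂ ▸ hM.mem_of_isPushout H.flip hq) hx, hk _ _ _ hne ?_⟩
    exact (hpe.comp_mono (pushout.inr p q)).of_comp_mono h₁ _ (by rw [Category.assoc, h₂, H.w])

end Proto

/-! ### Changes of satisfaction -/

/-- Along some path of `c` the factorization through `g` of a morphism starting with `s₀` breaks
off at a node bound by `β'`. -/
def IsBlocked (M : MorphismProperty C) {P₀ D G : C} (c : NestedCondition.{w} C P₀) (s₀ : P₀ ⟶ D)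
    (g : D ⟶ G) (β' : Binding) : Prop :=
  ∃ (Q R : C) (d : NestedCondition.{w} C Q) (e : NestedCondition.{w} C R) (β : Binding)
    (π : TreePath c Q d β) (p : Q ⟶ R) (_ : Edge β d p e β') (s : Q ⟶ D) (q : R ⟶ G),
    π.map ≫ s = s₀ ∧ M q ∧ p ≫ q = s ≫ g ∧ ¬ ∃ s' : R ⟶ D, s' ≫ g = q

theorem Binding.flip_flip (β : Binding) : β.flip.flip = β := by cases β <;> rfl

/-- Here `d₀` is a Boolean part, of polarity `γ`, of the condition `d` at the current node, and `hE`
embeds its edges into those of `d`. The claim is symmetric under exchanging `g` with `h` and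
flipping `γ`, which is the negation case. -/
theorem isBlocked_of_sat (hM : IsAdhesiveHLR M) {P₀ D : C} {c : NestedCondition.{w} C P₀}
    {s₀ : P₀ ⟶ D} {Q : C} (d₀ : NestedCondition.{w} C Q) :
    ∀ {G H : C} (g : D ⟶ G) (h : D ⟶ H), M g → M h → ∀ (γ β : Binding)
      (d : NestedCondition.{w} C Q) (π : TreePath c Q d β),
      (∀ (R : C) (p : Q ⟶ R) (e : NestedCondition.{w} C R) (β' : Binding),
        Edge γ d₀ p e β' → Edge β d p e β') → ∀ s : Q ⟶ D, π.map ≫ s = s₀ →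
      d₀.Sat M (s ≫ g) → ¬ d₀.Sat M (s ≫ h) →
      IsBlocked M c s₀ g γ ∨ IsBlocked M c s₀ h γ.flip := by
  induction d₀ with
  | tru P => intro _ _ _ _ _ _ _ _ _ _ _ _ _ _ h; exact absurd trivial h
  | neg d₀ ih =>
    intro G H g h hg hh γ β d π hE s hs h₁ h₂
    have := ih h g hh hg γ.flip β d π (fun R p e β' he => hE R p e β' (.neg he)) s hs
      (not_not.1 h₂) h₁
    rw [Binding.flip_flip] at this
    exact this.symm
  | conj d₀ ih =>
    intro G H g h hg hh γ β d π hE s hs h₁ h₂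
    obtain ⟨i, hi⟩ := not_forall.1 h₂
    exact ih i g h hg hh γ β d π (fun R p e β' he => hE R p e β' (.conj i he)) s hs (h₁ i) hi
  | disj d₀ ih =>
    intro G H g h hg hh γ β d π hE s hs h₁ h₂
    obtain ⟨i, hi⟩ := h₁
    exact ih i g h hg hh γ β d π (fun R p e β' he => hE R p e β' (.disj i he)) s hs hi
      (fun h' => h₂ ⟨i, h'⟩)
  | ex p d₁ ih =>
    intro G H g h hg hh γ β d π hE s hs h₁ h₂
    obtain ⟨q, hq, hpq, hd⟩ := h₁
    have he := hE _ p d₁ γ (.ex γ p d₁)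
    by_cases hf : ∃ s', s' ≫ g = q
    · obtain ⟨s', rfl⟩ := hf
      have := hM.mono _ hg
      have hps : p ≫ s' = s := by rw [← cancel_mono g, Category.assoc, hpq]
      refine ih g h hg hh γ γ d₁ (π.snoc p he) (fun _ _ _ _ h => h) s'
        (by rw [← hs, ← hps]; exact Category.assoc _ _ _) hd fun hd' => h₂ ?_
      -- The transported witness is in `M` because `s'` is, by cancelling `g`. If the body held
      -- there, `h₂` would be contradicted, so the body fails and the induction continues.
      exact ⟨s' ≫ h, hM.comp _ _ (hM.decomp _ _ hq hg) hh, by rw [← Category.assoc, hps], hd'⟩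
    · exact .inl ⟨_, _, d, d₁, β, π, p, he, s, q, hs, hq, hpq, hf⟩

section Blocked

variable {K L D G P₀ : C} {l : K ⟶ L} {k : K ⟶ D} {m : L ⟶ G} {g : D ⟶ G}
  {c : NestedCondition.{w} C P₀}

/-- A factorization through `D` at the end of the path restricts to every earlier node, so the
recursion meets only trivial essences and keeps advancing. -/
theorem TreePath.exists_isProtoEssenceAt (hM : IsAdhesiveHLR M) (hPB : HasPullbacks C)
    (hIPO : HasInitialPushouts M) (hI : HasMInitial M) (H : IsPushout l k m g) (hl : M l)
    {base : ℕ} {Q : C} {d : NestedCondition.{w} C Q} {β : Binding} (π : TreePath c Q d β)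
    (hπ : base ≤ π.length) : ∀ s : Q ⟶ D, ∃ pe : ProtoEssence M l c,
      IsProtoEssenceAt base l m π (s ≫ g) pe ∧ pe.diagram.IsTrivial := by
  induction π with
  | nil =>
    intro s
    obtain ⟨δ, hδ⟩ := exists_essenceDiagram hM hPB hIPO hl m (s ≫ g)
    exact ⟨_, .start _ _ δ (Nat.le_zero.1 hπ).symm hδ,
      (δ.isTrivial_iff hM hPB hI H hl hδ).2 ⟨s, rfl⟩⟩
  | snoc π p h ih =>
    intro s
    obtain ⟨δ, hδ⟩ := exists_essenceDiagram hM hPB hIPO hl m (s ≫ g)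
    have ht := (δ.isTrivial_iff hM hPB hI H hl hδ).2 ⟨s, rfl⟩
    rcases hπ.eq_or_lt with hb | hb
    · exact ⟨_, .start _ _ δ hb.symm hδ, ht⟩
    · obtain ⟨pe, hpe, hpt⟩ := ih (Nat.lt_succ_iff.1 hb) (p ≫ s)
      exact ⟨_, .next π p h _ pe (by simpa using hpe) hpt δ hδ, ht⟩

/-- A blocked node carries a nontrivial proto-essence. -/
theorem IsBlocked.exists_protoEssence (hM : IsAdhesiveHLR M) (hPB : HasPullbacks C)
    (hIPO : HasInitialPushouts M) (hI : HasMInitial M) (hE : HasPairFactorization E' M)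
    (hc : c.IsNormal M) (H : IsPushout l k m g) (hl : M l) {base : ℕ} (hbase : base ≤ 1)
    {s₀ : P₀ ⟶ D} {β' : Binding} (hb : IsBlocked M c s₀ g β') :
    ∃ pe : ProtoEssence M l c, pe ∈ protoEssences E' base l c ∧ ¬ pe.diagram.IsTrivial ∧ pe.binding = β' ∧
      ∃ q : pe.P ⟶ G, pe.path.map ≫ q = s₀ ≫ g ∧ pe.diagram.IsEssenceOf m q := by
  obtain ⟨Q, R, d, e, β, π, p, h, s, q, hs, hq, hpq, hn⟩ := hb
  obtain ⟨δ, hδ⟩ := exists_essenceDiagram hM hPB hIPO hl m q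
  have hne : ¬ δ.IsTrivial := fun ht => hn ((δ.isTrivial_iff hM hPB hI H hl hδ).1 ht)
  have hpe : IsProtoEssenceAt base l m (π.snoc p h) q ⟨R, e, β', π.snoc p h, δ⟩ := by
    -- A blocked node is never the root, so its level is at least `base`. Either the recursion
    -- starts here, or its previous value is trivial because `s` lands in `D`.
    rcases (hbase.trans (Nat.le_add_left 1 π.length)).eq_or_lt with hb | hb
    · exact .start _ _ δ hb.symm hδ
    · obtain ⟨pe, hpe, hpt⟩ := π.exists_isProtoEssenceAt hM hPB hIPO hI H hl
        (Nat.lt_succ_iff.1 hb) s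
      exact .next π p h _ pe (hpq ▸ hpe) hpt δ hδ
  refine ⟨_, mem_protoEssences hM hE hc hpe hne (.inr hq), hne, rfl, q, ?_, hδ⟩
  change (π.map ≫ p) ≫ q = _
  rw [Category.assoc, hpq, ← hs, Category.assoc]

end Blocked

/-! ### Embeddings -/

/-- Transformations restrict along monomorphisms through which the match factors. -/
theorem PreTransformation.exists_restrict (hM : IsAdhesiveHLR M) (hPB : HasPullbacks C)
    {ρ : Rule.{w} M} {G Y : C} (t : PreTransformation ρ G) (y : Y ⟶ G) [Mono y] (e : ρ.L ⟶ Y)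
    (he : e ≫ y = t.m) : ∃ s : PreTransformation ρ Y, s.m = e := by
  -- Since `y` is monic, the pullback of the match along `y` is `ρ.L` itself; pulling back the left
  -- pushout therefore restricts it to `Y`.
  obtain ⟨b, hb, -⟩ := hM.exists_isPushout_of_isPullback t.left ρ.l_mem
    (isPullback_id_of_mono he) (IsPullback.id_vert ρ.l) (IsPullback.of_hasPullback y t.g)
  have := hM.hasPushout ρ.r b ρ.r_mem
  exact ⟨⟨e, _, _, b, _, _, _, hb, IsPushout.of_hasPushout ρ.r b⟩, rfl⟩

/-- The required overlap is the `E'`-part of `(t₁.m, q)`: both transformations restrict along the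
remaining `M`-morphism, which also reflects the pullback. -/
theorem Essence.embeds (hM : IsAdhesiveHLR M) (hPB : HasPullbacks C)
    (hE : HasPairFactorization E' M) {ρ₁ ρ₂ : Rule.{w} M} {G : C} {t₁ : PreTransformation ρ₁ G}
    {t₂ : PreTransformation ρ₂ G} {ε : Essence ρ₁ ρ₂} (q : ε.P ⟶ G) (hq : ε.p ≫ q = t₂.m)
    (h : IsPullback ε.a ε.b t₁.m q) : ε.EmbedsInOverlap E' ∧ ε.toOverlap.EmbeddedIn t₁ t₂ := by
  refine ⟨?_, t₁.m, q, Category.id_comp _, hq, h⟩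
  obtain ⟨Y, e₁, e₂, y, he, hy, h₁, h₂⟩ := hE.exists_factor t₁.m q
  have := hM.mono _ hy
  obtain ⟨s₁, hs₁⟩ := t₁.exists_restrict hM hPB y e₁ h₁
  obtain ⟨s₂, hs₂⟩ := t₂.exists_restrict hM hPB y (ε.p ≫ e₂) (by rw [Category.assoc, h₂, hq])
  refine ⟨Y, e₁, e₂, s₁, s₂, he, hs₁, hs₂, (Category.id_comp _).trans hs₁.symm, hs₂.symm, ?_⟩
  exact isPullback_of_comp_mono y (h₁.symm ▸ h₂.symm ▸ h)

/-! ### From nontrivial proto-essences to disabling essences -/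

section Conflict

variable {ρ₁ ρ₂ : Rule.{w} M} {G : C} {t₁ : PreTransformation ρ₁ G} {t₂ : PreTransformation ρ₂ G}

theorem exists_disablingEssence_of_deletion (hM : IsAdhesiveHLR M) (hPB : HasPullbacks C)
    (hE : HasPairFactorization E' M) {pe : ProtoEssence M ρ₁.l ρ₂.ac}
    (hpe : pe ∈ protoEssencesByDeletion E' ρ₁ ρ₂) (hne : ¬ pe.diagram.IsTrivial)
    (hb : pe.binding = .existential ∨ pe.path.length = 0) {q : pe.P ⟶ G}
    (hq : pe.path.map ≫ q = t₂.m) (hδ : pe.diagram.IsEssenceOf t₁.m q) :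
    ∃ de ∈ disablingEssences E' ρ₁ ρ₂, de.toOverlap.EmbeddedIn t₁ t₂ := by
  obtain ⟨h₁, h₂⟩ := Essence.embeds (ε := pe.toEssence) hM hPB hE q hq hδ
  exact ⟨_, .inl ⟨pe, hpe, rfl, h₁, hb, hne⟩, h₂⟩

theorem exists_disablingEssence_of_insertion (hM : IsAdhesiveHLR M) (hPB : HasPullbacks C)
    (hE : HasPairFactorization E' M) {pe : ProtoEssence M ρ₁.r ρ₂.ac}
    (hpe : pe ∈ protoEssencesByInsertion E' ρ₁ ρ₂) (hne : ¬ pe.diagram.IsTrivial)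
    (hb : pe.binding = .universal) {s₀ : ρ₂.L ⟶ t₁.D} (hs₀ : s₀ ≫ t₁.g = t₂.m)
    {q : pe.P ⟶ t₁.H} (hq : pe.path.map ≫ q = s₀ ≫ t₁.h) (hδ : pe.diagram.IsEssenceOf t₁.n q) :
    ∃ de ∈ disablingEssences E' ρ₁ ρ₂, de.toOverlap.EmbeddedIn t₁ t₂ := by
  -- The pushout complement `P'` is the pullback of `q` along `t₁.h`, and `L₂ ⟶ P'` is induced by
  -- `s₀`.
  obtain ⟨b', hb', hu⟩ := hM.exists_isPushout_of_isPullback t₁.right ρ₁.r_mem hδ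
    pe.diagram.isPullback (IsPullback.of_hasPullback q t₁.h)
  have hsh := IsShift.mk (pe := pe) _ b' (pullback.fst q t₁.h) (pullback.lift _ _ hq) hb'
    (pullback.lift_fst _ _ _)
  -- The left square of `t₁` is a pullback as well, so pasting turns the pullback over `D₁` into one
  -- over `G`: the shifted span embeds through `P' ⟶ D₁ ⟶ G`.
  have := hu.flip.paste_horiz (hM.isPullback t₁.left ρ₁.l_mem)
  obtain ⟨h₁, h₂⟩ := Essence.embeds (t₂ := t₂) (ε := ⟨_, _, _, pe.diagram.β,
    pe.diagram.u ≫ ρ₁.l, b', pullback.lift _ _ hq⟩) hM hPB hE (pullback.snd q t₁.h ≫ t₁.g)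
    (by rw [← hs₀]; exact pullback.lift_snd_assoc _ _ _ _) this
  exact ⟨_, .inr ⟨pe, hpe, hsh, h₁, hb, hne⟩, h₂⟩

end Conflict

theorem exists_disablingEssence_of_causesConflict (hM : IsAdhesiveHLR M) (hPB : HasPullbacks C)
    (hIPO : HasInitialPushouts M) (hI : HasMInitial M) (hE : HasPairFactorization E' M)
    {ρ₁ ρ₂ : Rule.{w} M} {G : C} {t₁ : Transformation ρ₁ G} {t₂ : Transformation ρ₂ G}
    (h : CausesConflict t₁ t₂) : ∃ de ∈ disablingEssences E' ρ₁ ρ₂,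
      de.toOverlap.EmbeddedIn t₁.toPreTransformation t₂.toPreTransformation := by
  rcases h with h | ⟨d₁, hd₁, hsat⟩
  · obtain ⟨δ, hδ⟩ := exists_essenceDiagram hM hPB hIPO ρ₁.l_mem t₁.m t₂.m
    have hne : ¬ δ.IsTrivial :=
      fun ht => h ((δ.isTrivial_iff hM hPB hI t₁.left ρ₁.l_mem hδ).1 ht)
    have hpe : IsProtoEssenceAt 0 ρ₁.l t₁.m (.nil (c := ρ₂.ac)) t₂.m ⟨_, _, _, .nil, δ⟩ :=
      .start _ _ δ rfl hδ
    exact exists_disablingEssence_of_deletion hM hPB hE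
      (mem_protoEssences hM hE ρ₂.ac_normal hpe hne (.inl rfl)) hne (.inl rfl)
      (Category.id_comp _) hδ
  · have hblk := isBlocked_of_sat hM (c := ρ₂.ac) (s₀ := d₁) ρ₂.ac t₁.g t₁.h
      (hM.mem_of_isPushout t₁.left ρ₁.l_mem) (hM.mem_of_isPushout t₁.right ρ₁.r_mem)
      .existential .existential _ .nil (fun _ _ _ _ h => h) d₁ (Category.id_comp _)
      (hd₁ ▸ t₂.sat) hsat
    -- The descent began with existential polarity, so blocking in `G` is existential (deletion,
    -- `base = 0`), and blocking in `H₁` is universal (insertion, `base = 1`, with `r₁` in place of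
    -- `l₁`).
    rcases hblk with hblk | hblk
    · obtain ⟨pe, hpe, hne, hb, q, hq, hδ⟩ := hblk.exists_protoEssence (base := 0) hM hPB hIPO hI
        hE ρ₂.ac_normal t₁.left ρ₁.l_mem (Nat.zero_le 1)
      exact exists_disablingEssence_of_deletion hM hPB hE hpe hne (.inl hb) (hq.trans hd₁) hδ
    · obtain ⟨pe, hpe, hne, hb, q, hq, hδ⟩ := hblk.exists_protoEssence (base := 1) hM hPB hIPO hI
        hE ρ₂.ac_normal t₁.right ρ₁.r_mem le_rfl
      exact exists_disablingEssence_of_insertion hM hPB hE hpe hne hb hd₁ hq hδ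

/-- Absence of a conflict constrains every factorization through the pushout complement, so any
choice of `d₁` and `d₂` will do. -/
theorem causesConflict_of_not_parallelIndependent {ρ₁ ρ₂ : Rule.{w} M} {G : C}
    {t₁ : Transformation ρ₁ G} {t₂ : Transformation ρ₂ G} (h : ¬ ParallelIndependent t₁ t₂) :
    CausesConflict t₁ t₂ ∨ CausesConflict t₂ t₁ := by
  by_contra hc
  obtain ⟨h₁, h₂⟩ := not_or.1 hc
  obtain ⟨h₁, h₁'⟩ := not_or.1 h₁
  obtain ⟨h₂, h₂'⟩ := not_or.1 h₂
  obtain ⟨d₁, hd₁⟩ := not_not.1 h₁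
  obtain ⟨d₂, hd₂⟩ := not_not.1 h₂
  exact h ⟨d₁, d₂, hd₁, hd₂, by_contra fun hs => h₁' ⟨d₁, hd₁, hs⟩,
    by_contra fun hs => h₂' ⟨d₂, hd₂, hs⟩⟩

end GraphTransformation

theorem mainTheorem5 {C : Type u} [Category.{v} C] (M : MorphismProperty C)
    (E' : GraphTransformation.CospanClass C)
    (hM : GraphTransformation.IsAdhesiveHLR M) (hPB : HasPullbacks C)
    (hIPO : GraphTransformation.HasInitialPushouts M)
    (hI : GraphTransformation.HasMInitial M)
    (hE : GraphTransformation.HasPairFactorization E' M)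
    (ρ₁ ρ₂ : GraphTransformation.Rule.{w} M) (G : C)
    (t₁ : GraphTransformation.Transformation ρ₁ G)
    (t₂ : GraphTransformation.Transformation ρ₂ G) :
    (GraphTransformation.CausesConflict t₁ t₂ →
      ∃ de ∈ GraphTransformation.disablingEssences E' ρ₁ ρ₂,
        de.toOverlap.EmbeddedIn t₁.toPreTransformation t₂.toPreTransformation) ∧
    (¬ GraphTransformation.ParallelIndependent t₁ t₂ →
      (∃ de ∈ GraphTransformation.disablingEssences E' ρ₁ ρ₂,
        de.toOverlap.EmbeddedIn t₁.toPreTransformation t₂.toPreTransformation) ∨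
      (∃ de ∈ GraphTransformation.disablingEssences E' ρ₂ ρ₁,
        de.toOverlap.EmbeddedIn t₂.toPreTransformation t₁.toPreTransformation)) := by
  have key {ρ ρ' : GraphTransformation.Rule.{w} M} {t : GraphTransformation.Transformation ρ G}
      {t' : GraphTransformation.Transformation ρ' G} :=
    GraphTransformation.exists_disablingEssence_of_causesConflict (t₁ := t) (t₂ := t')
      hM hPB hIPO hI hE
  exact ⟨key, fun h =>
    (GraphTransformation.causesConflict_of_not_parallelIndependent h).imp key key⟩
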